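/- For real parameters $a_1,\dots,a_6$ consider the planar quadratic system $$x'=a_1x-y-a_3x^2+(2a_2+a_5)xy+a_6y^2,\qquad y'=x+a_1y+a_2x^2+(2a_3+a_4)xy-a_2y^2. \tag{1}$$ Put $$f(\theta)=-a_3\cos^3\theta+(3a_2+a_5)\cos^2\theta\sin\theta+(2a_3+a_4+a_6)\cos\theta\sin^2\theta-a_2\sin^3\theta,$$ $$g(\theta)=a_2\cos^3\theta+(3a_3+a_4)\cos^2\theta\sin\theta-(3a_2+a_5)\cos\theta\sin^2\theta-a_6\sin^3\theta,$$ and let $$\rho'=A(\theta)\rho^3+B(\theta)\rho^2+a_1\rho,\qquad A=g\,(a_1g-f),\quad B=f-2a_1g-g', \tag{2}$$ be the associated Abel equation. A $2\pi$-periodic function $F$ has definite sign if $F\ge 0$ on all of $[0,2\pi]$ or $F\le 0$ on all of $[0,2\pi]$. A limit cycle of (1) is the orbit of a nonconstant periodic solution that is isolated among the periodic orbits (it has a neighbourhood that contains no other periodic orbit); it surrounds the origin if the origin is off it and lies in a bounded component of its complement. Theorem. The function $B$ has definite sign if and only if it is identically zero, and this happens if and only if $(a_1,\dots,a_6)$ lies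 in one of the two subvarieties of $\mathbb{R}^6$ given by $$a_4+4a_6=4a_3+a_4=4a_2+a_5=a_1=0$$ or by $$a_6=3a_3+a_4=4a_2+a_5=3a_1a_5+2a_4=0.$$ Both are regular varieties of codimension four: they are nonempty and Zariski closed, every irreducible component has dimension $2$, and at each of their points the gradients of the polynomials vanishing on the variety span a space of dimension $4$. Moreover, if $B$ has definite sign, then (2) is the Bernoulli equation $\rho'=a_1\rho+A(\theta)\rho^3$, and system (1) has at most one limit cycle surrounding the origin. -/

import Mathlib

namespace QuadraticAbel

noncomputable section

/-! ### The quadratic system -/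

/-- The planar quadratic vector field
`x' = a₁ x - y - a₃ x² + (2 a₂ + a₅) x y + a₆ y²`,
`y' = x + a₁ y + a₂ x² + (2 a₃ + a₄) x y - a₂ y²`. -/
def quadraticField (a₁ a₂ a₃ a₄ a₅ a₆ : ℝ) (p : ℝ × ℝ) : ℝ × ℝ :=
  (a₁ * p.1 - p.2 - a₃ * p.1 ^ 2 + (2 * a₂ + a₅) * p.1 * p.2 + a₆ * p.2 ^ 2,
   p.1 + a₁ * p.2 + a₂ * p.1 ^ 2 + (2 * a₃ + a₄) * p.1 * p.2 - a₂ * p.2 ^ 2)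

/-- `γ` is the orbit of a nonconstant periodic solution of `z' = X z`. -/
def IsPeriodicOrbit (X : ℝ × ℝ → ℝ × ℝ) (γ : Set (ℝ × ℝ)) : Prop :=
  ∃ (z : ℝ → ℝ × ℝ) (T : ℝ), (∀ t, HasDerivAt z (X (z t)) t) ∧
    0 < T ∧ Function.Periodic z T ∧ (¬ ∃ c, ∀ t, z t = c) ∧ Set.range z = γ

/-- A limit cycle is a periodic orbit that is isolated among the periodic orbits: some
neighbourhood of it contains no other periodic orbit. -/
def IsLimitCycle (X : ℝ × ℝ → ℝ × ℝ) (γ : Set (ℝ × ℝ)) : Prop :=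
  IsPeriodicOrbit X γ ∧
    ∃ U : Set (ℝ × ℝ), IsOpen U ∧ γ ⊆ U ∧ ∀ γ', IsPeriodicOrbit X γ' → γ' ⊆ U → γ' = γ

/-- The closed curve `γ` surrounds the point `p`: the point is off the curve, and the connected
component of the complement of `γ` that contains `p` is bounded. -/
def Surrounds (γ : Set (ℝ × ℝ)) (p : ℝ × ℝ) : Prop :=
  p ∉ γ ∧ Bornology.IsBounded (connectedComponentIn γᶜ p)

/-! ### The Abel equation -/

/-- The cubic trigonometric polynomial `f` of the polar equation
`dr/dθ = (a₁ r + f(θ) r²) / (1 + g(θ) r)`. -/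
def polarF (a₂ a₃ a₄ a₅ a₆ θ : ℝ) : ℝ :=
  -a₃ * Real.cos θ ^ 3 + (3 * a₂ + a₅) * Real.cos θ ^ 2 * Real.sin θ
    + (2 * a₃ + a₄ + a₆) * Real.cos θ * Real.sin θ ^ 2 - a₂ * Real.sin θ ^ 3

/-- The cubic trigonometric polynomial `g` of the polar equation. -/
def polarG (a₂ a₃ a₄ a₅ a₆ θ : ℝ) : ℝ :=
  a₂ * Real.cos θ ^ 3 + (3 * a₃ + a₄) * Real.cos θ ^ 2 * Real.sin θ
    - (3 * a₂ + a₅) * Real.cos θ * Real.sin θ ^ 2 - a₆ * Real.sin θ ^ 3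

/-- The coefficient `A = g (a₁ g - f)` of the Abel equation. -/
def abelA (a₁ a₂ a₃ a₄ a₅ a₆ θ : ℝ) : ℝ :=
  polarG a₂ a₃ a₄ a₅ a₆ θ * (a₁ * polarG a₂ a₃ a₄ a₅ a₆ θ - polarF a₂ a₃ a₄ a₅ a₆ θ)

/-- The coefficient `B = f - 2 a₁ g - g'` of the Abel equation. -/
def abelB (a₁ a₂ a₃ a₄ a₅ a₆ θ : ℝ) : ℝ :=
  polarF a₂ a₃ a₄ a₅ a₆ θ - 2 * a₁ * polarG a₂ a₃ a₄ a₅ a₆ θ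
    - deriv (polarG a₂ a₃ a₄ a₅ a₆) θ

/-- The right-hand side of the Abel equation `ρ' = A(θ) ρ³ + B(θ) ρ² + a₁ ρ`. -/
def abelRHS (a₁ a₂ a₃ a₄ a₅ a₆ θ ρ : ℝ) : ℝ :=
  abelA a₁ a₂ a₃ a₄ a₅ a₆ θ * ρ ^ 3 + abelB a₁ a₂ a₃ a₄ a₅ a₆ θ * ρ ^ 2 + a₁ * ρ

/-- A (`2π`-periodic) function has definite sign if it is nonnegative on all of `[0, 2π]`
or nonpositive on all of `[0, 2π]`. -/
def HasDefiniteSign (F : ℝ → ℝ) : Prop :=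
  (∀ θ ∈ Set.Icc 0 (2 * Real.pi), 0 ≤ F θ) ∨ (∀ θ ∈ Set.Icc 0 (2 * Real.pi), F θ ≤ 0)

/-! ### Varieties in the parameter space

A point `a : Fin 6 → ℝ` of the parameter space has the coordinates
`(a₁, a₂, a₃, a₄, a₅, a₆) = (a 0, a 1, a 2, a 3, a 4, a 5)`. -/

/-- The variety `a₄ + 4 a₆ = 4 a₃ + a₄ = 4 a₂ + a₅ = a₁ = 0`. -/
def varietyOne : Set (Fin 6 → ℝ) :=
  {a | a 3 + 4 * a 5 = 0 ∧ 4 * a 2 + a 3 = 0 ∧ 4 * a 1 + a 4 = 0 ∧ a 0 = 0}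

/-- The variety `a₆ = 3 a₃ + a₄ = 4 a₂ + a₅ = 3 a₁ a₅ + 2 a₄ = 0`. -/
def varietyTwo : Set (Fin 6 → ℝ) :=
  {a | a 5 = 0 ∧ 3 * a 2 + a 3 = 0 ∧ 4 * a 1 + a 4 = 0 ∧ 3 * a 0 * a 4 + 2 * a 3 = 0}

/-- The gradient at `a` of a real polynomial in `n` variables. -/
def gradientAt {n : ℕ} (a : Fin n → ℝ) (p : MvPolynomial (Fin n) ℝ) : Fin n → ℝ :=
  fun j => MvPolynomial.eval a (MvPolynomial.pderiv j p)

/-- `V ⊆ ℝⁿ` is a regular (nonsingular) algebraic variety of codimension `c`: it is nonempty and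
Zariski closed; every irreducible component, that is, every minimal prime `P` of the ideal `I(V)`,
has Krull dimension `n - c`; and at every point of `V` the Jacobian of `I(V)`, whose rows are the
gradients of the members of `I(V)`, has rank `c`. -/
def IsRegularVarietyOfCodim {n : ℕ} (V : Set (Fin n → ℝ)) (c : ℕ) : Prop :=
  V.Nonempty ∧
    MvPolynomial.zeroLocus ℝ (MvPolynomial.vanishingIdeal ℝ V) = V ∧
    (∀ P ∈ (MvPolynomial.vanishingIdeal ℝ V).minimalPrimes,
      ringKrullDim (MvPolynomial (Fin n) ℝ ⧸ P) + (c : WithBot ℕ∞) = (n : WithBot ℕ∞)) ∧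
    ∀ a ∈ V, Module.finrank ℝ (Submodule.span ℝ
      (gradientAt a '' (MvPolynomial.vanishingIdeal ℝ V : Set (MvPolynomial (Fin n) ℝ)))) = c

end

end QuadraticAbel

namespace QuadraticAbel

/-! ### Graphs of polynomial maps are regular varieties -/

section Graph

open MvPolynomial

variable {m n : ℕ}

/-- The point of `ℝⁿ` with the parameter `u` on the variety parametrized by `φ`. -/
noncomputable def parametrizedPoint (φ : Fin n → MvPolynomial (Fin m) ℝ) (u : Fin m → ℝ) :
    Fin n → ℝ :=
  fun i => eval u (φ i)

theorem eval_parametrizedPoint (φ : Fin n → MvPolynomial (Fin m) ℝ) (u : Fin m → ℝ)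
    (p : MvPolynomial (Fin n) ℝ) :
    eval (parametrizedPoint φ u) p = eval u (aeval φ p) := by
  induction p using MvPolynomial.induction_on with
  | C r => simp
  | add p q hp hq => simp [-aeval_eq_bind₁, hp, hq]
  | mul_X p i hp => simp [hp, parametrizedPoint]

theorem mem_vanishingIdeal_range_iff (φ : Fin n → MvPolynomial (Fin m) ℝ)
    (p : MvPolynomial (Fin n) ℝ) :
    p ∈ vanishingIdeal ℝ (Set.range (parametrizedPoint φ)) ↔ aeval φ p = 0 := by
  rw [mem_vanishingIdeal_iff]
  constructor
  · intro h
    refine MvPolynomial.funext fun u => ?_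
    rw [← eval_parametrizedPoint, map_zero]
    simpa [aeval_eq_eval] using h _ ⟨u, rfl⟩
  · rintro h _ ⟨u, rfl⟩
    rw [aeval_eq_eval, eval_parametrizedPoint, h, map_zero]

theorem vanishingIdeal_range_eq_ker (φ : Fin n → MvPolynomial (Fin m) ℝ) :
    vanishingIdeal ℝ (Set.range (parametrizedPoint φ)) =
      RingHom.ker (aeval φ : MvPolynomial (Fin n) ℝ →ₐ[ℝ] MvPolynomial (Fin m) ℝ) := by
  ext p
  rw [mem_vanishingIdeal_range_iff, RingHom.mem_ker]

theorem pderiv_aeval (φ : Fin n → MvPolynomial (Fin m) ℝ) (k : Fin m)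
    (p : MvPolynomial (Fin n) ℝ) :
    pderiv k (aeval φ p) = ∑ i, aeval φ (pderiv i p) * pderiv k (φ i) := by
  induction p using MvPolynomial.induction_on with
  | C r => simp
  | add p q hp hq => simp [-aeval_eq_bind₁, hp, hq, add_mul, Finset.sum_add_distrib]
  | mul_X p i hp =>
    simp only [map_mul, aeval_X, Derivation.leibniz, smul_eq_mul, hp, map_add, add_mul,
      Finset.sum_add_distrib, Finset.mul_sum]
    congr 1
    · rw [Finset.sum_eq_single i]
      · simp
      · intro j _ hj
        simp [pderiv_X_of_ne hj.symm]
      · simp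
    · exact Finset.sum_congr rfl fun j _ => by ring

/-- The transpose of the Jacobian of a polynomial parametrization. -/
noncomputable def jacobianTranspose (φ : Fin n → MvPolynomial (Fin m) ℝ) (u : Fin m → ℝ) :
    (Fin n → ℝ) →ₗ[ℝ] (Fin m → ℝ) where
  toFun v k := ∑ i, v i * eval u (pderiv k (φ i))
  map_add' v w := by
    ext k
    simp [add_mul, Finset.sum_add_distrib]
  map_smul' r v := by
    ext k
    simp [Finset.mul_sum, mul_assoc]

variable {φ : Fin n → MvPolynomial (Fin m) ℝ} {j : Fin m → Fin n}

/-- The graph equation `x i = φ i (x ∘ j)`. -/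
noncomputable def graphEquation (φ : Fin n → MvPolynomial (Fin m) ℝ) (j : Fin m → Fin n)
    (i : Fin n) : MvPolynomial (Fin n) ℝ :=
  X i - aeval (fun k => X (j k)) (φ i)

theorem aeval_aeval_section (hφ : ∀ k, φ (j k) = X k) (q : MvPolynomial (Fin m) ℝ) :
    aeval φ (aeval (fun k => (X (j k) : MvPolynomial (Fin n) ℝ)) q) = q := by
  induction q using MvPolynomial.induction_on with
  | C r => simp
  | add p q hp hq => simp [-aeval_eq_bind₁, hp, hq]
  | mul_X p i hp => simp [-aeval_eq_bind₁, hp, hφ]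

theorem graphEquation_mem (hφ : ∀ k, φ (j k) = X k) (i : Fin n) :
    graphEquation φ j i ∈ vanishingIdeal ℝ (Set.range (parametrizedPoint φ)) := by
  rw [mem_vanishingIdeal_range_iff, graphEquation, map_sub, aeval_aeval_section hφ, aeval_X,
    sub_self]

theorem zeroLocus_vanishingIdeal_range (hφ : ∀ k, φ (j k) = X k) :
    zeroLocus ℝ (vanishingIdeal ℝ (Set.range (parametrizedPoint φ))) =
      Set.range (parametrizedPoint φ) := by
  refine Set.Subset.antisymm (fun a ha => ⟨fun k => a (j k), funext fun i => ?_⟩)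
    (zeroLocus_vanishingIdeal_le _)
  have h := ha _ (graphEquation_mem hφ i)
  have h' : ∀ q : MvPolynomial (Fin m) ℝ,
      eval a (aeval (fun k => (X (j k) : MvPolynomial (Fin n) ℝ)) q) =
        eval (fun k => a (j k)) q := fun q =>
    (eval_parametrizedPoint (fun k => X (j k)) a q).symm.trans
      (congrArg (fun b => eval b q) (funext fun k => eval_X _))
  rw [aeval_eq_eval, graphEquation] at h
  simp only [map_sub, eval_X, h'] at h
  simp only [parametrizedPoint]
  linarith

theorem jacobianTranspose_single (hφ : ∀ k, φ (j k) = X k) (u : Fin m → ℝ) (w : Fin m → ℝ) :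
    jacobianTranspose φ u (∑ k, w k • Pi.single (j k) 1) = w := by
  rw [map_sum]
  have h : ∀ k, jacobianTranspose φ u (Pi.single (j k) 1) = Pi.single k 1 := by
    intro k
    ext l
    simp only [jacobianTranspose, LinearMap.coe_mk, AddHom.coe_mk]
    rw [Finset.sum_eq_single (j k)]
    · rw [hφ]
      by_cases hkl : k = l
      · subst hkl
        simp
      · simp [Ne.symm hkl, pderiv_X, hkl]
    · intro i _ hi
      simp [Pi.single_eq_of_ne hi]
    · simp
  simp only [map_smul, h]
  ext l
  simp [Finset.sum_apply, Pi.single_apply]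

theorem span_gradients_eq_ker (hφ : ∀ k, φ (j k) = X k) (u : Fin m → ℝ) :
    Submodule.span ℝ (gradientAt (parametrizedPoint φ u) ''
      (vanishingIdeal ℝ (Set.range (parametrizedPoint φ)) : Set (MvPolynomial (Fin n) ℝ))) =
      LinearMap.ker (jacobianTranspose φ u) := by
  apply le_antisymm
  · rw [Submodule.span_le]
    rintro _ ⟨p, hp, rfl⟩
    rw [SetLike.mem_coe, mem_vanishingIdeal_range_iff] at hp
    rw [SetLike.mem_coe, LinearMap.mem_ker]
    ext k
    have h := congrArg (eval u) (pderiv_aeval φ k p)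
    rw [hp] at h
    simp only [map_zero, map_sum, map_mul] at h
    simp only [jacobianTranspose, LinearMap.coe_mk, AddHom.coe_mk, gradientAt,
      eval_parametrizedPoint, Pi.zero_apply]
    exact h.symm
  · intro v hv
    have hgrad : ∀ i, gradientAt (parametrizedPoint φ u) (graphEquation φ j i) =
        Pi.single i 1 - ∑ k, eval u (pderiv k (φ i)) • Pi.single (j k) (1 : ℝ) := by
      intro i
      ext l
      have hcomp : ∀ q : MvPolynomial (Fin m) ℝ,
          pderiv l (aeval (fun k => (X (j k) : MvPolynomial (Fin n) ℝ)) q) =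
            ∑ k, aeval (fun k => (X (j k) : MvPolynomial (Fin n) ℝ)) (pderiv k q) *
              pderiv l (X (j k)) :=
        pderiv_aeval _ l
      simp only [gradientAt, graphEquation, map_sub, hcomp, map_sum, map_mul,
        eval_parametrizedPoint, aeval_aeval_section hφ]
      simp [pderiv_X, Pi.single_apply, eq_comm, apply_ite]
    have hsum : v = ∑ i, v i • gradientAt (parametrizedPoint φ u) (graphEquation φ j i) := by
      have hv' : ∀ k, ∑ i, v i * eval u (pderiv k (φ i)) = 0 := fun k => congrFun hv k
      simp only [hgrad, smul_sub, Finset.sum_sub_distrib, Finset.smul_sum, smul_smul]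
      rw [Finset.sum_comm (s := Finset.univ (α := Fin n)) (t := Finset.univ (α := Fin m))]
      simp only [← Finset.sum_smul, hv', zero_smul, Finset.sum_const_zero, sub_zero]
      ext l
      simp [Finset.sum_apply, Pi.single_apply]
    rw [hsum]
    exact Submodule.sum_mem _ fun i _ => Submodule.smul_mem _ _
      (Submodule.subset_span ⟨_, graphEquation_mem hφ i, rfl⟩)

theorem isRegularVarietyOfCodim_range {c : ℕ} (hc : m + c = n) (hφ : ∀ k, φ (j k) = X k) :
    IsRegularVarietyOfCodim (Set.range (parametrizedPoint φ)) c := by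
  refine ⟨⟨_, 0, rfl⟩, zeroLocus_vanishingIdeal_range hφ, ?_, ?_⟩
  · rw [vanishingIdeal_range_eq_ker]
    have hprime : (RingHom.ker (aeval φ : MvPolynomial (Fin n) ℝ →ₐ[ℝ]
        MvPolynomial (Fin m) ℝ)).IsPrime := RingHom.ker_isPrime _
    rw [Ideal.minimalPrimes_eq_subsingleton_self]
    rintro P rfl
    have e := Ideal.quotientKerAlgEquivOfSurjective (f := (aeval φ : MvPolynomial (Fin n) ℝ →ₐ[ℝ]
        MvPolynomial (Fin m) ℝ)) (fun q => ⟨_, aeval_aeval_section hφ q⟩)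
    rw [ringKrullDim_eq_of_ringEquiv e.toRingEquiv, MvPolynomial.ringKrullDim_of_isNoetherianRing,
      ringKrullDim_eq_zero_of_field, Nat.card_fin, zero_add, ← hc]
    push_cast
    rfl
  · rintro _ ⟨u, rfl⟩
    rw [span_gradients_eq_ker hφ]
    have hsurj : LinearMap.range (jacobianTranspose φ u) = ⊤ :=
      LinearMap.range_eq_top.2 fun w => ⟨_, jacobianTranspose_single hφ u w⟩
    have h := LinearMap.finrank_range_add_finrank_ker (jacobianTranspose φ u)
    rw [hsurj, finrank_top, Module.finrank_fin_fun, Module.finrank_fin_fun] at h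
    omega

theorem isRegularVarietyOfCodim_varietyOne : IsRegularVarietyOfCodim varietyOne 4 := by
  have h : varietyOne = Set.range (parametrizedPoint
      ![0, X 0, X 1, -4 * X 1, -4 * X 0, (X 1 : MvPolynomial (Fin 2) ℝ)]) := by
    ext a
    constructor
    · rintro ⟨h1, h2, h3, h4⟩
      refine ⟨![a 1, a 2], funext fun i => ?_⟩
      fin_cases i <;> simp [parametrizedPoint] <;> linarith
    · rintro ⟨u, rfl⟩
      simp [varietyOne, parametrizedPoint]
  rw [h]
  exact isRegularVarietyOfCodim_range (j := ![1, 2]) rfl fun k => by fin_cases k <;> rfl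

theorem isRegularVarietyOfCodim_varietyTwo : IsRegularVarietyOfCodim varietyTwo 4 := by
  have h : varietyTwo = Set.range (parametrizedPoint
      ![X 0, X 1, -2 * X 0 * X 1, 6 * X 0 * X 1, -4 * X 1, (0 : MvPolynomial (Fin 2) ℝ)]) := by
    ext a
    constructor
    · rintro ⟨h1, h2, h3, h4⟩
      have h5 : a 4 = -4 * a 1 := by linarith
      rw [h5] at h4
      refine ⟨![a 0, a 1], funext fun i => ?_⟩
      fin_cases i <;> simp [parametrizedPoint] <;> linarith
    · rintro ⟨u, rfl⟩
      simp only [varietyTwo, parametrizedPoint, Set.mem_ofPred_eq]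
      refine ⟨?_, ?_, ?_, ?_⟩ <;> simp <;> ring
  rw [h]
  exact isRegularVarietyOfCodim_range (j := ![0, 1]) rfl fun k => by fin_cases k <;> rfl

end Graph
/-! ### The sign of the coefficient `B` -/

section Sign

variable (a₁ a₂ a₃ a₄ a₅ a₆ : ℝ)

theorem hasDerivAt_polarG (θ : ℝ) :
    HasDerivAt (polarG a₂ a₃ a₄ a₅ a₆)
      ((3 * a₃ + a₄) * Real.cos θ ^ 3 - (9 * a₂ + 2 * a₅) * Real.cos θ ^ 2 * Real.sin θ
        - (6 * a₃ + 2 * a₄ + 3 * a₆) * Real.cos θ * Real.sin θ ^ 2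
        + (3 * a₂ + a₅) * Real.sin θ ^ 3) θ := by
  have hc := Real.hasDerivAt_cos θ
  have hs := Real.hasDerivAt_sin θ
  refine (((((hc.pow 3).const_mul a₂).add (((hc.pow 2).const_mul (3 * a₃ + a₄)).mul hs)).sub
    ((hc.const_mul (3 * a₂ + a₅)).mul (hs.pow 2))).sub ((hs.pow 3).const_mul a₆)).congr_deriv ?_
  simp
  ring

theorem abelB_eq (θ : ℝ) :
    abelB a₁ a₂ a₃ a₄ a₅ a₆ θ =
      -(4 * a₃ + a₄ + 2 * a₁ * a₂) * Real.cos θ ^ 3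
      + (3 * (4 * a₂ + a₅) - 2 * a₁ * (3 * a₃ + a₄)) * Real.cos θ ^ 2 * Real.sin θ
      + (8 * a₃ + 3 * a₄ + 4 * a₆ + 2 * a₁ * (3 * a₂ + a₅)) * Real.cos θ * Real.sin θ ^ 2
      + (2 * a₁ * a₆ - (4 * a₂ + a₅)) * Real.sin θ ^ 3 := by
  rw [abelB, (hasDerivAt_polarG a₂ a₃ a₄ a₅ a₆ θ).deriv, polarF, polarG]
  ring

theorem abelB_add_pi (θ : ℝ) :
    abelB a₁ a₂ a₃ a₄ a₅ a₆ (θ + Real.pi) = -abelB a₁ a₂ a₃ a₄ a₅ a₆ θ := by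
  simp only [abelB_eq, Real.cos_add_pi, Real.sin_add_pi]
  ring

variable {a₁ a₂ a₃ a₄ a₅ a₆}

theorem abelB_eq_zero_of_mem_Icc (h : HasDefiniteSign (abelB a₁ a₂ a₃ a₄ a₅ a₆)) {θ : ℝ}
    (h0 : 0 ≤ θ) (hπ : θ ≤ Real.pi) : abelB a₁ a₂ a₃ a₄ a₅ a₆ θ = 0 := by
  have hp := Real.pi_pos
  have h1 : θ ∈ Set.Icc 0 (2 * Real.pi) := ⟨h0, by linarith⟩
  have h2 : θ + Real.pi ∈ Set.Icc 0 (2 * Real.pi) := ⟨by linarith, by linarith⟩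
  rcases h with h | h <;>
  · have e1 := h _ h1
    have e2 := h _ h2
    rw [abelB_add_pi] at e2
    linarith

theorem mem_varieties_of_hasDefiniteSign (h : HasDefiniteSign (abelB a₁ a₂ a₃ a₄ a₅ a₆)) :
    ![a₁, a₂, a₃, a₄, a₅, a₆] ∈ varietyOne ∪ varietyTwo := by
  have hp := Real.pi_pos
  have e0 := abelB_eq_zero_of_mem_Icc h le_rfl hp.le
  have e1 := abelB_eq_zero_of_mem_Icc h (θ := Real.pi / 2) (by linarith) (by linarith)
  have e2 := abelB_eq_zero_of_mem_Icc h (θ := Real.pi / 4) (by linarith) (by linarith)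
  have e3 := abelB_eq_zero_of_mem_Icc h (θ := Real.pi - Real.pi / 4) (by linarith) (by linarith)
  rw [abelB_eq] at e0 e1 e2 e3
  rw [Real.cos_pi_sub, Real.sin_pi_sub] at e3
  rw [Real.cos_pi_div_four, Real.sin_pi_div_four] at e2 e3
  simp only [Real.cos_zero, Real.sin_zero, Real.cos_pi_div_two, Real.sin_pi_div_two] at e0 e1
  have hs : (Real.sqrt 2 / 2) ^ 3 ≠ 0 := by positivity
  have k1 : 4 * a₃ + a₄ + 2 * a₁ * a₂ = 0 := by linarith
  have k4 : 2 * a₁ * a₆ - (4 * a₂ + a₅) = 0 := by linarith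
  rw [k1, k4] at e2 e3
  have k2 : 3 * (4 * a₂ + a₅) - 2 * a₁ * (3 * a₃ + a₄) = 0 := by
    apply (mul_eq_zero.1 _).resolve_right hs
    linear_combination (e2 + e3) / 2
  have k3 : 8 * a₃ + 3 * a₄ + 4 * a₆ + 2 * a₁ * (3 * a₂ + a₅) = 0 := by
    apply (mul_eq_zero.1 _).resolve_right hs
    linear_combination (e2 - e3) / 2
  by_cases ha : a₁ = 0
  · subst ha
    left
    change a₄ + 4 * a₆ = 0 ∧ 4 * a₃ + a₄ = 0 ∧ 4 * a₂ + a₅ = 0 ∧ (0 : ℝ) = 0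
    refine ⟨?_, ?_, ?_, rfl⟩ <;> linarith
  · right
    change a₆ = 0 ∧ 3 * a₃ + a₄ = 0 ∧ 4 * a₂ + a₅ = 0 ∧ 3 * a₁ * a₅ + 2 * a₄ = 0
    have m1 : 3 * a₃ + a₄ = 3 * a₆ := by
      apply mul_left_cancel₀ (mul_ne_zero two_ne_zero ha)
      linarith
    have m2 : a₆ = 0 := by
      have : a₆ * (16 + 4 * a₁ ^ 2) = 0 := by
        linear_combination k3 + k1 - 4 * m1 + 2 * a₁ * k4
      exact (mul_eq_zero.1 this).resolve_right (by positivity)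
    subst m2
    have m3 : 4 * a₂ + a₅ = 0 := by linarith
    exact ⟨rfl, by linarith, m3, by linear_combination 3 * a₁ * m3 + 8 * m1 - 6 * k1⟩

theorem abelB_eq_zero_of_mem (h : ![a₁, a₂, a₃, a₄, a₅, a₆] ∈ varietyOne ∪ varietyTwo) (θ : ℝ) :
    abelB a₁ a₂ a₃ a₄ a₅ a₆ θ = 0 := by
  rw [abelB_eq]
  rcases h with h | h
  · obtain ⟨h1, h2, h3, h4⟩ :
      a₄ + 4 * a₆ = 0 ∧ 4 * a₃ + a₄ = 0 ∧ 4 * a₂ + a₅ = 0 ∧ a₁ = 0 := h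
    subst h4
    have k3 : 8 * a₃ + 3 * a₄ + 4 * a₆ = 0 := by linarith
    simp [h2, h3, k3]
  · obtain ⟨h1, h2, h3, h4⟩ :
      a₆ = 0 ∧ 3 * a₃ + a₄ = 0 ∧ 4 * a₂ + a₅ = 0 ∧ 3 * a₁ * a₅ + 2 * a₄ = 0 := h
    obtain rfl : a₄ = -3 * a₃ := by linarith
    obtain rfl : a₅ = -4 * a₂ := by linarith
    obtain rfl : a₃ = -2 * a₁ * a₂ := by linarith
    subst h1
    ring

theorem hasDefiniteSign_of_eq_zero (h : ∀ θ, abelB a₁ a₂ a₃ a₄ a₅ a₆ θ = 0) :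
    HasDefiniteSign (abelB a₁ a₂ a₃ a₄ a₅ a₆) :=
  Or.inl fun θ _ => (h θ).ge

end Sign

/-! ### Periodic orbits on the second variety -/

section Focus

theorem eq_mul_exp_of_hasDerivAt {h q : ℝ → ℝ} (hq : Continuous q)
    (hh : ∀ t, HasDerivAt h (q t * h t) t) (t : ℝ) :
    h t = h 0 * Real.exp (∫ s in (0 : ℝ)..t, q s) := by
  have hQ : ∀ t, HasDerivAt (fun t => ∫ s in (0 : ℝ)..t, q s) (q t) t := fun t =>
    intervalIntegral.integral_hasDerivAt_right (hq.intervalIntegrable _ _)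
      hq.aestronglyMeasurable.stronglyMeasurableAtFilter hq.continuousAt
  have hd : ∀ t, HasDerivAt (fun t => h t * Real.exp (-∫ s in (0 : ℝ)..t, q s)) 0 t := fun t =>
    ((hh t).mul (hQ t).neg.exp).congr_deriv (by ring)
  have hc := is_const_of_deriv_eq_zero (fun t => (hd t).differentiableAt)
    (fun t => (hd t).deriv) t 0
  simp only [intervalIntegral.integral_same, neg_zero, Real.exp_zero, mul_one] at hc
  rw [← hc, mul_assoc, ← Real.exp_add, neg_add_cancel, Real.exp_zero, mul_one]

theorem not_periodic_of_hasDerivAt_pos {f f' : ℝ → ℝ} {T : ℝ} (hT : 0 < T)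
    (hf : ∀ t, HasDerivAt f (f' t) t) (hf' : ∀ t, 0 < f' t) : ¬ Function.Periodic f T :=
  fun hp => by
    have h := strictMono_of_hasDerivAt_pos hf hf' hT
    have h0 := hp 0
    rw [zero_add] at h0
    exact h.ne h0.symm

theorem not_periodic_of_hasDerivAt_neg {f f' : ℝ → ℝ} {T : ℝ} (hT : 0 < T)
    (hf : ∀ t, HasDerivAt f (f' t) t) (hf' : ∀ t, f' t < 0) : ¬ Function.Periodic f T :=
  fun hp => by
    have h := strictAnti_of_hasDerivAt_neg hf hf' hT
    have h0 := hp 0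
    rw [zero_add] at h0
    exact h.ne h0

theorem not_surrounds_of_forall_lt {b : ℝ} {γ : Set (ℝ × ℝ)} (h : ∀ p ∈ γ, 1 + b * p.1 < 0) :
    ¬ Surrounds γ (0, 0) := by
  rintro ⟨-, hb⟩
  set S : Set (ℝ × ℝ) := {p | 0 ≤ 1 + b * p.1} with hS
  have hconv : Convex ℝ S := by
    intro p hp q hq s t hs ht hst
    simp only [hS, Set.mem_ofPred_eq, Prod.fst_add, Prod.smul_fst, smul_eq_mul] at hp hq ⊢
    have : 1 + b * (s * p.1 + t * q.1) = s * (1 + b * p.1) + t * (1 + b * q.1) := by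
      linear_combination -hst
    rw [this]
    positivity
  have hsub : S ⊆ connectedComponentIn γᶜ (0, 0) :=
    hconv.isPreconnected.subset_connectedComponentIn (by simp [hS])
      fun p hp hpγ => absurd (h p hpγ) (not_lt.2 hp)
  obtain ⟨R, hR⟩ := (hb.subset hsub).exists_norm_le
  have h1 := hR (0, |R| + 1) (by simp [hS])
  have h2 := (norm_snd_le _).trans h1
  rw [Real.norm_eq_abs, abs_of_nonneg (by positivity)] at h2
  linarith [le_abs_self R]

/-- With a nonzero trace, `(1 + 2 a₂ x) / (x² + y²)` is monotone along the orbits near the origin,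
so none of them is periodic. -/
theorem not_surrounds_of_ne_zero {a₁ a₂ : ℝ} (ha : a₁ ≠ 0) {γ : Set (ℝ × ℝ)}
    (hγ : IsPeriodicOrbit
      (quadraticField a₁ a₂ (-2 * a₁ * a₂) (6 * a₁ * a₂) (-4 * a₂) 0) γ) :
    ¬ Surrounds γ (0, 0) := by
  obtain ⟨z, T, hz, hT, hper, -, rfl⟩ := hγ
  intro hsur
  have hx : ∀ t, HasDerivAt (fun t => (z t).1)
      ((a₁ * (z t).1 - (z t).2) * (1 + 2 * a₂ * (z t).1)) t := fun t =>
    (hasFDerivAt_fst.comp_hasDerivAt t (hz t)).congr_deriv (by simp only [quadraticField, ContinuousLinearMap.coe_fst']; ring)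
  have hy : ∀ t, HasDerivAt (fun t => (z t).2)
      ((z t).1 + a₁ * (z t).2 + a₂ * (z t).1 ^ 2 + 2 * a₁ * a₂ * (z t).1 * (z t).2
        - a₂ * (z t).2 ^ 2) t := fun t =>
    (hasFDerivAt_snd.comp_hasDerivAt t (hz t)).congr_deriv (by simp only [quadraticField, ContinuousLinearMap.coe_snd']; ring)
  have hzc : Continuous z := continuous_iff_continuousAt.2 fun t => (hz t).continuousAt
  have hh : ∀ t, HasDerivAt (fun t => 1 + 2 * a₂ * (z t).1)
      (2 * a₂ * (a₁ * (z t).1 - (z t).2) * (1 + 2 * a₂ * (z t).1)) t := fun t =>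
    (((hx t).const_mul (2 * a₂)).const_add 1).congr_deriv (by ring)
  have hexp := eq_mul_exp_of_hasDerivAt (q := fun t => 2 * a₂ * (a₁ * (z t).1 - (z t).2))
    (by fun_prop) hh
  rcases lt_trichotomy (1 + 2 * a₂ * (z 0).1) 0 with h0 | h0 | h0
  · refine not_surrounds_of_forall_lt (b := 2 * a₂) ?_ hsur
    rintro _ ⟨t, rfl⟩
    rw [hexp t]
    exact mul_neg_of_neg_of_pos h0 (Real.exp_pos _)
  · have hline : ∀ t, 1 + 2 * a₂ * (z t).1 = 0 := fun t => by rw [hexp t, h0, zero_mul]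
    refine not_periodic_of_hasDerivAt_neg (f := fun t => a₂ * (z t).2)
      (f' := fun t => -(1 / 4) - (a₂ * (z t).2) ^ 2) hT
      (fun t => ((hy t).const_mul a₂).congr_deriv ?_) (fun t => by linarith [sq_nonneg (a₂ * (z t).2)])
      fun t => by simp only [hper t]
    linear_combination (1 / 4 + a₂ * (z t).1 / 2 + a₁ * a₂ * (z t).2) * hline t
  · have hpos : ∀ t, 0 < 1 + 2 * a₂ * (z t).1 := fun t => by
      rw [hexp t]
      exact mul_pos h0 (Real.exp_pos _)
    have hR : ∀ t, 0 < (z t).1 ^ 2 + (z t).2 ^ 2 := fun t => by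
      refine lt_of_le_of_ne (by positivity) fun h => hsur.1 ⟨t, ?_⟩
      have e1 : (z t).1 = 0 := by nlinarith [sq_nonneg (z t).1, sq_nonneg (z t).2]
      have e2 : (z t).2 = 0 := by nlinarith [sq_nonneg (z t).1, sq_nonneg (z t).2]
      exact Prod.ext e1 e2
    have hV : ∀ t, HasDerivAt
        (fun t => (1 + 2 * a₂ * (z t).1) / ((z t).1 ^ 2 + (z t).2 ^ 2))
        (-2 * a₁ * ((1 + a₂ * (z t).1) * (1 + 2 * a₂ * (z t).1) /
          ((z t).1 ^ 2 + (z t).2 ^ 2))) t := fun t => by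
      refine ((hh t).div (((hx t).pow 2).add ((hy t).pow 2)) (hR t).ne').congr_deriv ?_
      have := (hR t).ne'
      simp only [Pi.add_apply, Pi.pow_apply]
      field_simp
      push_cast
      ring
    have hVper : Function.Periodic
        (fun t => (1 + 2 * a₂ * (z t).1) / ((z t).1 ^ 2 + (z t).2 ^ 2)) T :=
      fun t => by simp only [hper t]
    have hfac : ∀ t, 0 < (1 + a₂ * (z t).1) * (1 + 2 * a₂ * (z t).1) /
        ((z t).1 ^ 2 + (z t).2 ^ 2) := fun t =>
      div_pos (mul_pos (by linarith [hpos t]) (hpos t)) (hR t)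
    rcases lt_or_gt_of_ne ha with ha | ha
    · exact not_periodic_of_hasDerivAt_pos hT hV
        (fun t => mul_pos (by linarith) (hfac t)) hVper
    · exact not_periodic_of_hasDerivAt_neg hT hV
        (fun t => mul_neg_of_neg_of_pos (by linarith) (hfac t)) hVper

end Focus

/-! ### Periodic orbits on the first variety -/

section Center

open Complex

theorem hasDerivAt_equivRealProd_iff {a₂ a₃ : ℝ} {ζ : ℝ → ℂ} {t : ℝ} :
    HasDerivAt (fun t => equivRealProdCLM (ζ t))
      (quadraticField 0 a₂ a₃ (-4 * a₃) (-4 * a₂) a₃ (equivRealProdCLM (ζ t))) t ↔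
      HasDerivAt ζ (I * ζ t + (-a₃ + a₂ * I) * ζ t ^ 2) t := by
  have key : quadraticField 0 a₂ a₃ (-4 * a₃) (-4 * a₂) a₃ (equivRealProdCLM (ζ t)) =
      equivRealProdCLM (I * ζ t + (-a₃ + a₂ * I) * ζ t ^ 2) := by
    simp only [quadraticField, equivRealProdCLM_apply, pow_two]
    ext <;> simp <;> ring
  rw [key]
  constructor
  · intro h
    have h' := (equivRealProdCLM.symm.toContinuousLinearMap.hasFDerivAt
      (x := equivRealProdCLM (ζ t))).comp_hasDerivAt t h
    simpa only [Function.comp_def, ContinuousLinearEquiv.coe_coe,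
      ContinuousLinearEquiv.symm_apply_apply] using h'
  · intro h
    exact equivRealProdCLM.toContinuousLinearMap.hasFDerivAt.comp_hasDerivAt t h

/-- The solutions of `ζ' = i ζ + c ζ²` off the origin are the inverses of uniform rotations about
the point `i c`. -/
theorem hasDerivAt_inv_rotation {c k : ℂ} {t : ℝ} (h : I * c + k * exp (-(t * I)) ≠ 0) :
    HasDerivAt (fun t : ℝ => (I * c + k * exp (-(t * I)))⁻¹)
      (I * (I * c + k * exp (-(t * I)))⁻¹ + c * (I * c + k * exp (-(t * I)))⁻¹ ^ 2) t := by
  have h1 : HasDerivAt (fun t : ℝ => exp (-(t * I))) (exp (-(t * I)) * (-I)) t :=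
    ((((hasDerivAt_id t).ofReal_comp).mul_const I).neg.cexp).congr_deriv (by simp)
  refine (((h1.const_mul k).const_add (I * c)).fun_inv h).congr_deriv ?_
  field_simp
  linear_combination -c * I_sq

theorem eq_inv_rotation {c : ℂ} {ζ : ℝ → ℂ} (h0 : ∀ t, ζ t ≠ 0)
    (hζ : ∀ t, HasDerivAt ζ (I * ζ t + c * ζ t ^ 2) t) :
    ∃ k : ℂ, ∀ t : ℝ, ζ t = (I * c + k * exp (-(t * I)))⁻¹ := by
  have hd : ∀ t : ℝ, HasDerivAt (fun t : ℝ => ((ζ t)⁻¹ - I * c) * exp (t * I)) 0 t := by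
    intro t
    have h1 : HasDerivAt (fun t : ℝ => exp (t * I)) (exp (t * I) * I) t :=
      ((((hasDerivAt_id t).ofReal_comp).mul_const I).cexp).congr_deriv (by simp)
    refine ((((hζ t).fun_inv (h0 t)).sub_const (I * c)).mul h1).congr_deriv ?_
    have := h0 t
    field_simp
    linear_combination -c * ζ t * exp (I * t) * I_sq
  refine ⟨((ζ 0)⁻¹ - I * c), fun t => ?_⟩
  have hc := is_const_of_deriv_eq_zero (fun t => (hd t).differentiableAt)
    (fun t => (hd t).deriv) t 0
  simp only [ofReal_zero, zero_mul, exp_zero, mul_one] at hc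
  rw [← hc, mul_assoc, ← exp_add, add_neg_cancel, exp_zero, mul_one, add_sub_cancel, inv_inv]

theorem not_isLimitCycle_of_center {a₂ a₃ : ℝ} {γ : Set (ℝ × ℝ)} (h0 : (0, 0) ∉ γ) :
    ¬ IsLimitCycle (quadraticField 0 a₂ a₃ (-4 * a₃) (-4 * a₂) a₃) γ := by
  rintro ⟨⟨z, T, hz, hT, hper, hnc, rfl⟩, U, hU, hzU, hiso⟩
  set c : ℂ := -a₃ + a₂ * I with hc
  set ζ : ℝ → ℂ := fun t => equivRealProdCLM.symm (z t) with hζdef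
  have hzζ : ∀ t, z t = equivRealProdCLM (ζ t) := fun t => by simp [hζdef]
  have hζ0 : ∀ t, ζ t ≠ 0 := fun t h => h0 ⟨t, by rw [hzζ, h]; simp⟩
  have hζ : ∀ t, HasDerivAt ζ (I * ζ t + c * ζ t ^ 2) t := fun t => by
    have h := hz t
    rw [funext hzζ] at h
    exact hasDerivAt_equivRealProd_iff.1 h
  obtain ⟨k, hk⟩ := eq_inv_rotation hζ0 hζ
  have hk0 : k ≠ 0 := by
    rintro rfl
    exact hnc ⟨equivRealProdCLM (I * c)⁻¹, fun t => by rw [hzζ, hk]; simp⟩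
  have hne : ∀ t : ℝ, I * c + k * exp (-(t * I)) ≠ 0 := fun t h => hζ0 t (by rw [hk, h, inv_zero])
  -- the deformations of the orbit by a change of the radius `k`
  set F : ℝ × ℂ → ℂ := fun p => I * c + (p.1 * k) * p.2 with hF
  have hFc : Continuous F := by fun_prop
  set N : Set (ℝ × ℂ) := {p | F p ≠ 0 ∧ equivRealProdCLM (F p)⁻¹ ∈ U} with hN
  have hNo : IsOpen N := by
    have h1 : IsOpen {p | F p ≠ 0} := isOpen_ne_fun hFc continuous_const
    have h2 : ContinuousOn (fun p => equivRealProdCLM (F p)⁻¹) {p | F p ≠ 0} :=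
      equivRealProdCLM.continuous.comp_continuousOn (hFc.continuousOn.inv₀ fun _ hp => hp)
    exact h2.isOpen_inter_preimage h1 hU
  have hcover : ({1} : Set ℝ) ×ˢ Metric.sphere (0 : ℂ) 1 ⊆ N := by
    rintro ⟨r, w⟩ ⟨rfl, hw⟩
    obtain ⟨s, hs⟩ := (norm_eq_one_iff w).1 (by simpa using hw)
    have hFw : F (1, w) = I * c + k * exp (-((-s : ℝ) * I)) := by
      simp [hF, ← hs]
    refine ⟨by rw [hFw]; exact hne _, ?_⟩
    rw [hFw, ← hk, ← hzζ]
    exact hzU ⟨_, rfl⟩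
  obtain ⟨u, v, huo, -, hu, hv, huv⟩ :=
    generalized_tube_lemma isCompact_singleton (isCompact_sphere (0 : ℂ) 1) hNo hcover
  obtain ⟨ε, hε, hball⟩ := Metric.isOpen_iff.1 huo 1 (hu rfl)
  set r : ℝ := 1 + ε / 2 with hr
  have hru : r ∈ u := hball (by
    rw [Metric.mem_ball, Real.dist_eq, hr, add_sub_cancel_left, abs_of_pos (by linarith)]
    linarith)
  have hrN : ∀ t : ℝ, (r, exp (-(t * I))) ∈ N := fun t =>
    huv ⟨hru, hv (by
      have : -(t * I) = ((-t : ℝ) : ℂ) * I := by push_cast; ring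
      rw [mem_sphere_zero_iff_norm, this, norm_exp_ofReal_mul_I])⟩
  set η : ℝ → ℂ := fun t => (I * c + (r * k) * exp (-(t * I)))⁻¹ with hη
  have hηper : Function.Periodic η (2 * Real.pi) := fun t => by
    have : -(((t + 2 * Real.pi : ℝ) : ℂ) * I) = -(t * I) - 2 * Real.pi * I := by
      push_cast; ring
    simp only [hη, this, exp_periodic.sub_eq]
  have hrk : (r : ℂ) * k ≠ 0 := mul_ne_zero (ofReal_ne_zero.2 (by linarith)) hk0
  have horb : IsPeriodicOrbit (quadraticField 0 a₂ a₃ (-4 * a₃) (-4 * a₂) a₃)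
      (Set.range fun t => equivRealProdCLM (η t)) := by
    refine ⟨_, 2 * Real.pi, fun t => hasDerivAt_equivRealProd_iff.2
      (hasDerivAt_inv_rotation (hrN t).1), Real.two_pi_pos,
      fun t => congrArg equivRealProdCLM (hηper t), ?_, rfl⟩
    rintro ⟨d, hd⟩
    have h1 := equivRealProdCLM.injective ((hd 0).trans (hd Real.pi).symm)
    have h2 := add_left_cancel (inv_injective h1)
    have h3 := mul_left_cancel₀ hrk h2
    rw [exp_neg (Real.pi * I), exp_pi_mul_I] at h3
    norm_num at h3
  have heq := hiso _ horb (by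
    rintro _ ⟨t, rfl⟩
    exact (hrN t).2)
  obtain ⟨t, ht⟩ : equivRealProdCLM (η 0) ∈ Set.range z := heq ▸ ⟨0, rfl⟩
  rw [hzζ] at ht
  have h1 := equivRealProdCLM.injective ht
  rw [hk] at h1
  have h2 := add_left_cancel (inv_injective h1)
  have h3 : exp (((-t : ℝ) : ℂ) * I) = r := by
    apply mul_left_cancel₀ hk0
    simpa [mul_comm] using h2
  have h4 := congrArg norm h3
  rw [norm_exp_ofReal_mul_I, norm_real, Real.norm_eq_abs, abs_of_pos (by linarith)] at h4
  linarith

end Center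

theorem not_surrounds_of_isLimitCycle {a₁ a₂ a₃ a₄ a₅ a₆ : ℝ}
    (h : ![a₁, a₂, a₃, a₄, a₅, a₆] ∈ varietyOne ∪ varietyTwo) {γ : Set (ℝ × ℝ)}
    (hγ : IsLimitCycle (quadraticField a₁ a₂ a₃ a₄ a₅ a₆) γ) : ¬ Surrounds γ (0, 0) := by
  rcases h with h | h
  · obtain ⟨h1, h2, h3, rfl⟩ :
      a₄ + 4 * a₆ = 0 ∧ 4 * a₃ + a₄ = 0 ∧ 4 * a₂ + a₅ = 0 ∧ a₁ = 0 := h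
    obtain rfl : a₄ = -4 * a₃ := by linarith
    obtain rfl : a₅ = -4 * a₂ := by linarith
    obtain rfl : a₆ = a₃ := by linarith
    exact fun hs => not_isLimitCycle_of_center hs.1 hγ
  · obtain ⟨rfl, h2, h3, h4⟩ :
      a₆ = 0 ∧ 3 * a₃ + a₄ = 0 ∧ 4 * a₂ + a₅ = 0 ∧ 3 * a₁ * a₅ + 2 * a₄ = 0 := h
    obtain rfl : a₅ = -4 * a₂ := by linarith
    obtain rfl : a₄ = 6 * a₁ * a₂ := by linarith
    obtain rfl : a₃ = -2 * a₁ * a₂ := by linarith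
    by_cases ha : a₁ = 0
    · subst ha
      refine fun hs => not_isLimitCycle_of_center (a₂ := a₂) (a₃ := 0) hs.1 ?_
      simpa using hγ
    · exact not_surrounds_of_ne_zero ha hγ.1

end QuadraticAbel

theorem theoremB :
    QuadraticAbel.IsRegularVarietyOfCodim QuadraticAbel.varietyOne 4 ∧
    QuadraticAbel.IsRegularVarietyOfCodim QuadraticAbel.varietyTwo 4 ∧
    ∀ a₁ a₂ a₃ a₄ a₅ a₆ : ℝ,
      (QuadraticAbel.HasDefiniteSign (QuadraticAbel.abelB a₁ a₂ a₃ a₄ a₅ a₆) ↔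
        ∀ θ : ℝ, QuadraticAbel.abelB a₁ a₂ a₃ a₄ a₅ a₆ θ = 0) ∧
      (QuadraticAbel.HasDefiniteSign (QuadraticAbel.abelB a₁ a₂ a₃ a₄ a₅ a₆) ↔
        ![a₁, a₂, a₃, a₄, a₅, a₆] ∈ QuadraticAbel.varietyOne ∪ QuadraticAbel.varietyTwo) ∧
      (QuadraticAbel.HasDefiniteSign (QuadraticAbel.abelB a₁ a₂ a₃ a₄ a₅ a₆) →
        (∀ θ ρ : ℝ, QuadraticAbel.abelRHS a₁ a₂ a₃ a₄ a₅ a₆ θ ρ =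
          a₁ * ρ + QuadraticAbel.abelA a₁ a₂ a₃ a₄ a₅ a₆ θ * ρ ^ 3) ∧
        {γ : Set (ℝ × ℝ) |
          QuadraticAbel.IsLimitCycle (QuadraticAbel.quadraticField a₁ a₂ a₃ a₄ a₅ a₆) γ ∧
            QuadraticAbel.Surrounds γ (0, 0)}.Subsingleton) := by
  refine ⟨QuadraticAbel.isRegularVarietyOfCodim_varietyOne,
    QuadraticAbel.isRegularVarietyOfCodim_varietyTwo, fun a₁ a₂ a₃ a₄ a₅ a₆ => ?_⟩
  have hmem := QuadraticAbel.mem_varieties_of_hasDefiniteSign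
    (a₁ := a₁) (a₂ := a₂) (a₃ := a₃) (a₄ := a₄) (a₅ := a₅) (a₆ := a₆)
  have hzero := QuadraticAbel.abelB_eq_zero_of_mem
    (a₁ := a₁) (a₂ := a₂) (a₃ := a₃) (a₄ := a₄) (a₅ := a₅) (a₆ := a₆)
  refine ⟨⟨fun h => hzero (hmem h), QuadraticAbel.hasDefiniteSign_of_eq_zero⟩,
    ⟨hmem, fun h => QuadraticAbel.hasDefiniteSign_of_eq_zero (hzero h)⟩, fun h => ⟨?_, ?_⟩⟩
  · intro θ ρ
    rw [QuadraticAbel.abelRHS, hzero (hmem h)]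
    ring
  · rintro γ ⟨hγ, hs⟩
    exact absurd hs (QuadraticAbel.not_surrounds_of_isLimitCycle (hmem h) hγ)
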